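/- Let $\mathcal W$ be a probability distribution on $\mathbb R$ all of whose moments are finite, write $\mu_{\mathcal W}(k)=\int x^k\,d\mathcal W(x)$, and let $d\ge 0$ be an integer. **Spectral moments.** Let $\mathcal R_{N,d}$ be the set of simple $d$-regular graphs (no loops, no multiple edges) on the vertex set $\{1,\dots,N\}$. For $G\in\mathcal R_{N,d}$ with adjacency matrix $(a_{ij})$ let $(w_{ij})_{i\le j}$ be independent with law $\mathcal W$, let $A_{\mathbf w}$ be the real symmetric matrix with entries $w_{ij}a_{ij}$ for $i\le j$, and let $\nu_{d,G_{\mathbf w}}=\frac1N\sum_{n=1}^N\delta_{\lambda_n}$, where $\lambda_1\le\dots\le\lambda_N$ are the eigenvalues of $A_{\mathbf w}$. Put $$\mu_{d,\mathcal W}(k;G)=\mathbb E_{\mathbf w}\int x^k\,d\nu_{d,G_{\mathbf w}}(x),\qquad \mu_{d,\mathcal W}^{(N)}(k)=\frac1{|\mathcal R_{N,d}|}\sum_{G\in\mathcal R_{N,d}}\mu_{d,\mathcal W}(k;G).$$ **Patterns.** A closed acyclic path pattern of length $k$ is a string of $k$ symbols such that (1) every symbol that appears does so an even number of times, and (2)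 in the substring strictly between any two consecutive instances of the same symbol, every symbol that appears does so an even number of times. Let $\mathcal P_k$ be the set of these strings up to relabelling of the symbols. For $\pi\in\mathcal P_k$ let $e_1,\dots,e_r$ be its distinct symbols in order of first appearance. The string is the sequence of edges of a closed walk on a rooted tree, the diagram of $\pi$, that starts at the root: the symbols are the edges of the tree, and the vertex reached after $t$ steps corresponds to the set of symbols that occur an odd number of times among the first $t$ symbols (these are the edges that separate it from the root). Let $\alpha_j$ be the number of $i<j$ such that $e_i$ and $e_j$ share a vertex in the diagram, let $n_j$ be the number of times $e_j$ appears in $\pi$, let $\sigma(\pi)=(n_1,\dots,n_r)$, and put $$m_\pi(x)=\prod_{j=1}^r(x-\alpha_j),\qquad \mu_{\mathcal W}(\sigma(\pi))=\prod_{j=1}^r\mu_{\mathcal W}(n_j).$$ **Lemma (Moment Expansion).** For all sufficiently large $N$ with $dN$ even the set $\mathcal R_{N,d}$ is non-empty, and for all $N\ge 1$, $k\ge 0$ and $G\in\mathcal R_{N,d}$ the random variable $\int x^k\,d\nu_{d,G_{\mathbf w}}(x)$ is integrable, so that the averages above are well defined. For every integer $k\ge 0$, $$\lim_{\substack{N\to\infty\\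 dN\text{ even}}}\mu_{d,\mathcal W}^{(N)}(k)=\sum_{\pi\in\mathcal P_k}m_\pi(d)\,\mu_{\mathcal W}(\sigma(\pi)).$$ In particular, for every odd $k$ this limit is $0$. -/

import Mathlib

open MeasureTheory Filter Topology

noncomputable section

namespace WeightedRegular

/-! ### Randomly weighted regular graphs and their spectral moments -/

open Classical in
/-- The set `R_{N,d}` of simple `d`-regular graphs on the labelled vertex set `Fin N`. -/
def regularGraphs (N d : ℕ) : Finset (SimpleGraph (Fin N)) :=
  Finset.univ.filter fun G => G.IsRegularOfDegree d

open Classical in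
/-- The adjacency matrix of `G` with edges weighted by `w`. A symmetric family of weights
`w_{ij}`, `i ≤ j`, is a function on the unordered pairs of vertices. -/
def weightedAdj {N : ℕ} (G : SimpleGraph (Fin N)) (w : Sym2 (Fin N) → ℝ) :
    Matrix (Fin N) (Fin N) ℝ :=
  Matrix.of fun i j => if G.Adj i j then w s(i, j) else 0

theorem weightedAdj_isHermitian {N : ℕ} (G : SimpleGraph (Fin N)) (w : Sym2 (Fin N) → ℝ) :
    (weightedAdj G w).IsHermitian := by
  ext i j
  have hs : s(j, i) = s(i, j) := Sym2.eq_swap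
  by_cases hij : G.Adj i j
  · simp [weightedAdj, hij, hij.symm, hs]
  · have hji : ¬G.Adj j i := fun h => hij h.symm
    simp [weightedAdj, hij, hji]

/-- The uniform probability measure on the spectrum (eigenvalues counted with multiplicity)
of the weighted graph. -/
def spectralMeasure {N : ℕ} (G : SimpleGraph (Fin N)) (w : Sym2 (Fin N) → ℝ) : Measure ℝ :=
  (N : ENNReal)⁻¹ • ∑ i, Measure.dirac ((weightedAdj_isHermitian G w).eigenvalues i)

/-- The `k`-th moment of a measure on the line. -/
def moment (ν : Measure ℝ) (k : ℕ) : ℝ := ∫ x, x ^ k ∂ν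

/-- The law of a family of independent weights drawn from `W`. -/
def weightLaw (W : Measure ℝ) (N : ℕ) : Measure (Sym2 (Fin N) → ℝ) :=
  Measure.pi fun _ => W

/-- The average, over independent weights drawn from `W`, of the `k`-th spectral moment of the
weighted graph `G`. -/
def graphMoment (W : Measure ℝ) {N : ℕ} (G : SimpleGraph (Fin N)) (k : ℕ) : ℝ :=
  ∫ w, moment (spectralMeasure G w) k ∂(weightLaw W N)

/-- The average of `graphMoment` over all simple `d`-regular graphs on `N` labelled vertices. -/
def averageMoment (W : Measure ℝ) (d N k : ℕ) : ℝ :=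
  (∑ G ∈ regularGraphs N d, graphMoment W G k) / ((regularGraphs N d).card : ℝ)

/-- `N` tends to infinity through the values with `N * d` even, which for `N > d` are exactly the
values for which a `d`-regular graph on `N` vertices exists. -/
def admissible (d : ℕ) : Filter ℕ := atTop ⊓ 𝓟 {N | Even (N * d)}

/-! ### Closed acyclic path patterns

A string of length `k` over an alphabet `α` is a function `Fin k → α`. -/

section Strings

variable {k : ℕ} {α β : Type*}

open Classical in
/-- A closed acyclic string: every symbol appears an even number of times, and every symbol
appears an even number of times strictly between any two consecutive instances of the same
symbol. -/
def IsClosedAcyclic (s : Fin k → α) : Prop :=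
  (∀ a : α, Even (Finset.univ.filter fun l => s l = a).card) ∧
  ∀ i j : Fin k, i < j → s i = s j → (∀ l, i < l → l < j → s l ≠ s i) →
    ∀ a : α, Even (Finset.univ.filter fun l => i < l ∧ l < j ∧ s l = a).card

/-- Two strings differ only by a relabelling of the symbols. -/
def SamePattern (s : Fin k → α) (t : Fin k → β) : Prop :=
  ∀ i j, s i = s j ↔ t i = t j

/-- The positions at which a symbol appears for the first time. They index the distinct symbols
`e_1, e_2, …, e_r` of the string in order of appearance. -/
def IsFirst (s : Fin k → α) (i : Fin k) : Prop := ∀ j, j < i → s j ≠ s i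

open Classical in
/-- The finite set of first positions. -/
def firsts (s : Fin k → α) : Finset (Fin k) := Finset.univ.filter (IsFirst s)

open Classical in
/-- The vertex of the diagram reached after the first `t` steps. The symbols are the edges of
the diagram, which is a tree rooted at the start of the walk; a vertex of a tree is determined by
the set of edges that separate it from the root, and these are the edges that the walk has
crossed an odd number of times. The root is the empty set. -/
def vertexAt (s : Fin k → α) (t : ℕ) : Set α :=
  {a | Odd (Finset.univ.filter fun l : Fin k => (l : ℕ) < t ∧ s l = a).card}

/-- The (undirected) edge of the diagram traversed in step `i`. -/
def edgeAt (s : Fin k → α) (i : Fin k) : Sym2 (Set α) :=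
  s(vertexAt s (i : ℕ), vertexAt s ((i : ℕ) + 1))

/-- The edges of the diagram traversed in steps `i` and `j` are distinct and share a vertex. -/
def EdgesAdjacent (s : Fin k → α) (i j : Fin k) : Prop :=
  s i ≠ s j ∧ ∃ v, v ∈ edgeAt s i ∧ v ∈ edgeAt s j

open Classical in
/-- For a first position `i`, the number of symbols that appear earlier than the symbol `s i` and
whose edges in the diagram are adjacent to its edge. -/
def alpha (s : Fin k → α) (i : Fin k) : ℕ :=
  ((firsts s).filter fun j => j < i ∧ EdgesAdjacent s j i).card

/-- The polynomial `∏_j (x - α_j)`, the product over the distinct symbols. -/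
def stringMultiplicity (s : Fin k → α) (x : ℝ) : ℝ :=
  ∏ i ∈ firsts s, (x - (alpha s i : ℝ))

open Classical in
/-- The number of times that the symbol at position `i` appears in the string. For `i` running
through the first positions these are the entries of the signature. -/
def signature (s : Fin k → α) (i : Fin k) : ℕ :=
  (Finset.univ.filter fun l => s l = s i).card

/-- The product of the moments of `W` whose orders are the entries of the signature. -/
def stringMoment (W : Measure ℝ) (s : Fin k → α) : ℝ :=
  ∏ i ∈ firsts s, moment W (signature s i)

/-! None of these quantities changes under a relabelling. -/

variable {s : Fin k → α} {t : Fin k → β}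

theorem SamePattern.firsts_eq (h : SamePattern s t) : firsts s = firsts t := by
  ext i
  simp only [firsts, Finset.mem_filter, IsFirst, ne_eq, h _ i]

theorem SamePattern.signature_eq (h : SamePattern s t) (i : Fin k) :
    signature s i = signature t i := by
  unfold signature
  congr 1
  ext l
  simp [h l i]

theorem SamePattern.mem_vertexAt (h : SamePattern s t) (n : ℕ) (i : Fin k) :
    s i ∈ vertexAt s n ↔ t i ∈ vertexAt t n := by
  classical
  have hc : ∀ l : Fin k, ((l : ℕ) < n ∧ s l = s i) ↔ ((l : ℕ) < n ∧ t l = t i) := fun l => by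
    rw [h l i]
  change Odd _ ↔ Odd _
  rw [Finset.filter_congr fun l _ => hc l]

theorem vertexAt_subset_range (s : Fin k → α) (n : ℕ) : vertexAt s n ⊆ Set.range s := by
  classical
  intro a ha
  obtain ⟨l, hl⟩ := Finset.card_pos.1 (Odd.pos ha)
  exact ⟨l, (Finset.mem_filter.1 hl).2.2⟩

theorem vertexAt_eq_iff (s : Fin k → α) (m n : ℕ) :
    vertexAt s m = vertexAt s n ↔ ∀ i, s i ∈ vertexAt s m ↔ s i ∈ vertexAt s n := by
  refine ⟨fun h i => by rw [h], fun h => Set.ext fun a => ⟨fun ha => ?_, fun ha => ?_⟩⟩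
  · obtain ⟨i, rfl⟩ := vertexAt_subset_range s m ha
    exact (h i).1 ha
  · obtain ⟨i, rfl⟩ := vertexAt_subset_range s n ha
    exact (h i).2 ha

theorem SamePattern.vertexAt_eq (h : SamePattern s t) (m n : ℕ) :
    vertexAt s m = vertexAt s n ↔ vertexAt t m = vertexAt t n := by
  simp only [vertexAt_eq_iff, h.mem_vertexAt]

theorem edgesAdjacent_iff (s : Fin k → α) (i j : Fin k) :
    EdgesAdjacent s i j ↔ s i ≠ s j ∧
      ((vertexAt s (i : ℕ) = vertexAt s (j : ℕ) ∨ vertexAt s (i : ℕ) = vertexAt s ((j : ℕ) + 1)) ∨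
        (vertexAt s ((i : ℕ) + 1) = vertexAt s (j : ℕ) ∨
          vertexAt s ((i : ℕ) + 1) = vertexAt s ((j : ℕ) + 1))) := by
  simp [EdgesAdjacent, edgeAt, or_and_right, exists_or]

theorem SamePattern.edgesAdjacent (h : SamePattern s t) (i j : Fin k) :
    EdgesAdjacent s i j ↔ EdgesAdjacent t i j := by
  simp only [edgesAdjacent_iff, h.vertexAt_eq, ne_eq, h i j]

theorem SamePattern.alpha_eq (h : SamePattern s t) (i : Fin k) : alpha s i = alpha t i := by
  unfold alpha
  congr 1
  ext j
  simp [h.firsts_eq, h.edgesAdjacent j i]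

theorem SamePattern.stringMultiplicity_eq (h : SamePattern s t) (x : ℝ) :
    stringMultiplicity s x = stringMultiplicity t x := by
  simp only [stringMultiplicity, h.firsts_eq, h.alpha_eq]

theorem SamePattern.stringMoment_eq (h : SamePattern s t) (W : Measure ℝ) :
    stringMoment W s = stringMoment W t := by
  simp only [stringMoment, h.firsts_eq, h.signature_eq]

end Strings

/-- Closed acyclic strings of length `k`, up to relabelling. A string of length `k` has at most
`k` distinct symbols, so an alphabet with `k` letters is enough. -/
def patternSetoid (k : ℕ) : Setoid {s : Fin k → Fin k // IsClosedAcyclic s} where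
  r s t := SamePattern s.1 t.1
  iseqv :=
    ⟨fun _ _ _ => Iff.rfl, fun h i j => (h i j).symm, fun h h' i j => (h i j).trans (h' i j)⟩

/-- The set `P_k` of closed acyclic path patterns of length `k`. -/
def Pattern (k : ℕ) : Type := Quotient (patternSetoid k)

open Classical in
instance (k : ℕ) : Fintype (Pattern k) :=
  inferInstanceAs (Fintype (Quotient (patternSetoid k)))

/-- The multiplicity `m_π(x)`. -/
def Pattern.multiplicity {k : ℕ} (π : Pattern k) (x : ℝ) : ℝ :=
  Quotient.lift (fun s : {s : Fin k → Fin k // IsClosedAcyclic s} => stringMultiplicity s.1 x)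
    (fun _ _ h => SamePattern.stringMultiplicity_eq h x) π

/-- The moment contribution `μ_W(σ(π))`. -/
def Pattern.moment {k : ℕ} (W : Measure ℝ) (π : Pattern k) : ℝ :=
  Quotient.lift (fun s : {s : Fin k → Fin k // IsClosedAcyclic s} => stringMoment W s.1)
    (fun _ _ h => SamePattern.stringMoment_eq h W) π

end WeightedRegular

end

noncomputable section

namespace WeightedRegular

open scoped Classical

/-! ### Diagram vertices of a string and comparison of prefixes -/

section Strings

variable {k : ℕ} {α β : Type*}

/-! The trace of `A ^ k` is a sum over closed walks of length `k`, and independence turns the mean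
weight of a walk into a product of moments of `W` that depends only on the pattern of its edge
string. So the moment of a graph is the average over its vertices `v` of `localMoment`, which sees
only the walks of length `k` from `v` (`graphMoment_eq_sum`).

Call `v` tree-like if no walk of length less than `k` from `v` can be continued to a visited vertex
along a fresh edge. From such a vertex, two times of a walk give the same vertex of the graph
exactly when they give the same vertex of the diagram (`IsTreeLikeAt.vertex_eq_iff`). Hence closed
walks have closed acyclic strings, and the walks following a given string can be counted step by
step: a repeated symbol forces the step, while a new symbol `e_j` allows each of the `d` edges at
the current vertex except those already used, which correspond to the `α_j` earlier symbols adjacent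
to `e_j`. The product of these numbers is `m_π(d)`, so the local moment equals the pattern sum
exactly, with no error (`IsTreeLikeAt.localMoment_eq`).

By edge switching, a fixed vertex fails to be tree-like in a proportion `O(1/N)` of the `d`-regular
graphs (`sum_card_returns_le`, `card_not_isTreeLikeAt_le`). Local moments at exceptional vertices
are bounded uniformly in `N`, so the averaged moment is within `O(1/N)` of the pattern sum. For odd
`k` the sum is empty, because closed acyclic strings have even length. -/

theorem vertexAt_zero (s : Fin k → α) : vertexAt s 0 = ∅ := by
  ext a
  simp [vertexAt]

theorem mem_vertexAt_succ (s : Fin k → α) (i : Fin k) (a : α) :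
    a ∈ vertexAt s ((i : ℕ) + 1) ↔ (a ∈ vertexAt s (i : ℕ) ↔ s i ≠ a) := by
  unfold vertexAt
  simp only [Set.mem_ofPred_eq]
  by_cases h : s i = a
  · have : (Finset.univ.filter fun l : Fin k => (l : ℕ) < (i : ℕ) + 1 ∧ s l = a) =
        insert i (Finset.univ.filter fun l : Fin k => (l : ℕ) < (i : ℕ) ∧ s l = a) := by
      ext l
      simp only [Finset.mem_filter, Finset.mem_univ, true_and, Finset.mem_insert, Fin.ext_iff]
      constructor
      · rintro ⟨h1, h2⟩
        by_cases h3 : (l : ℕ) = i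
        · exact Or.inl h3
        · exact Or.inr ⟨by omega, h2⟩
      · rintro (h1 | ⟨h1, h2⟩)
        · have : l = i := Fin.ext h1
          subst this
          exact ⟨by omega, h⟩
        · exact ⟨by omega, h2⟩
    rw [this, Finset.card_insert_of_notMem (by simp), Nat.odd_add_one]
    simp [h]
  · have : (Finset.univ.filter fun l : Fin k => (l : ℕ) < (i : ℕ) + 1 ∧ s l = a) =
        (Finset.univ.filter fun l : Fin k => (l : ℕ) < (i : ℕ) ∧ s l = a) := by
      ext l
      simp only [Finset.mem_filter, Finset.mem_univ, true_and]
      constructor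
      · rintro ⟨h1, h2⟩
        have : (l : ℕ) ≠ i := fun h3 => h (by rw [← Fin.ext h3]; exact h2)
        exact ⟨by omega, h2⟩
      · rintro ⟨h1, h2⟩
        exact ⟨by omega, h2⟩
    rw [this]
    simp [h]

theorem mem_vertexAt_top (s : Fin k → α) (a : α) :
    a ∈ vertexAt s k ↔ Odd (Finset.univ.filter fun l => s l = a).card := by
  simp [vertexAt]

theorem vertexAt_step_congr (s : Fin k → α) {i j : Fin k} (h : s i = s j)
    (hX : vertexAt s (i : ℕ) = vertexAt s (j : ℕ)) :
    vertexAt s ((i : ℕ) + 1) = vertexAt s ((j : ℕ) + 1) := by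
  ext a
  rw [mem_vertexAt_succ, mem_vertexAt_succ, h, hX]

/-- Crossing an edge toggles its symbol, so crossing it again at once from the far end undoes the
step. -/
theorem vertexAt_step_back (s : Fin k → α) {i j : Fin k} (h : s i = s j)
    (hX : vertexAt s ((i : ℕ) + 1) = vertexAt s (j : ℕ)) :
    vertexAt s ((j : ℕ) + 1) = vertexAt s (i : ℕ) := by
  ext a
  rw [mem_vertexAt_succ, ← hX, mem_vertexAt_succ, h]
  tauto

theorem mem_vertexAt_iff_of_between (s : Fin k → α) {m n : ℕ} (hmn : m ≤ n) (a : α) :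
    (a ∈ vertexAt s m ↔ a ∈ vertexAt s n) ↔
      Even (Finset.univ.filter fun l : Fin k => m ≤ (l : ℕ) ∧ (l : ℕ) < n ∧ s l = a).card := by
  have : (Finset.univ.filter fun l : Fin k => (l : ℕ) < n ∧ s l = a).card =
      (Finset.univ.filter fun l : Fin k => (l : ℕ) < m ∧ s l = a).card +
      (Finset.univ.filter fun l : Fin k => m ≤ (l : ℕ) ∧ (l : ℕ) < n ∧ s l = a).card := by
    rw [← Finset.card_union_of_disjoint]
    · congr 1
      ext l
      simp only [Finset.mem_filter, Finset.mem_univ, true_and, Finset.mem_union]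
      constructor
      · rintro ⟨h1, h2⟩
        by_cases h3 : (l : ℕ) < m
        · exact Or.inl ⟨h3, h2⟩
        · exact Or.inr ⟨by omega, h1, h2⟩
      · rintro (⟨h1, h2⟩ | ⟨-, h1, h2⟩)
        · exact ⟨by omega, h2⟩
        · exact ⟨h1, h2⟩
    · rw [Finset.disjoint_left]
      intro l
      simp only [Finset.mem_filter, Finset.mem_univ, true_and]
      omega
  unfold vertexAt
  simp only [Set.mem_ofPred_eq, this, ← Nat.not_even_iff_odd, Nat.even_add]
  tauto

/-- If `s i` does not occur before position `i`, it is not in an earlier diagram vertex. -/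
theorem notMem_vertexAt (s : Fin k → α) {i : Fin k} (h : ∀ j, j < i → s j ≠ s i) {n : ℕ}
    (hn : n ≤ i) : s i ∉ vertexAt s n := by
  unfold vertexAt
  rw [Set.mem_ofPred_eq, Finset.filter_eq_empty_iff.2]
  · simp
  · rintro l - ⟨h1, h2⟩
    exact h l (by rw [Fin.lt_def]; omega) h2

/-- The strings agree up to relabelling in the first `t` positions. -/
def SamePrefix (t : ℕ) (s : Fin k → α) (r : Fin k → β) : Prop :=
  ∀ i j : Fin k, (i : ℕ) < t → (j : ℕ) < t → (s i = s j ↔ r i = r j)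

theorem samePrefix_top {s : Fin k → α} {r : Fin k → β} :
    SamePrefix k s r ↔ SamePattern s r :=
  ⟨fun h i j => h i j i.2 j.2, fun h i j _ _ => h i j⟩

/-- A symbol in a diagram vertex at time at most `t` occurs before time `t`, where equality of
symbols, and hence the parity of each count, is the same for both strings. -/
theorem SamePrefix.vertexAt_subset {t : ℕ} {s : Fin k → α} {r : Fin k → β}
    (h : SamePrefix t s r) {m n : ℕ} (hm : m ≤ t) (hn : n ≤ t)
    (hX : vertexAt s m = vertexAt s n) : vertexAt r m ⊆ vertexAt r n := by
  intro b hb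
  obtain ⟨l, hl⟩ := Finset.card_pos.1 (Odd.pos hb)
  obtain ⟨hl1, rfl⟩ := (Finset.mem_filter.1 hl).2
  have key : ∀ q ≤ t, (s l ∈ vertexAt s q ↔ r l ∈ vertexAt r q) := by
    intro q hq
    unfold vertexAt
    rw [Set.mem_ofPred_eq, Set.mem_ofPred_eq]
    have : ∀ x : Fin k, ((x : ℕ) < q ∧ s x = s l) ↔ ((x : ℕ) < q ∧ r x = r l) := fun x =>
      and_congr_right fun hx => h x l (by omega) (by omega)
    rw [Finset.filter_congr fun x _ => this x]
  rw [← key n hn, ← hX, key m hm]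
  exact hb

theorem SamePrefix.vertexAt_eq {t : ℕ} {s : Fin k → α} {r : Fin k → β}
    (h : SamePrefix t s r) {m n : ℕ} (hm : m ≤ t) (hn : n ≤ t) :
    vertexAt s m = vertexAt s n ↔ vertexAt r m = vertexAt r n := by
  have h' : SamePrefix t r s := fun i j hi hj => (h i j hi hj).symm
  exact ⟨fun e => (h.vertexAt_subset hm hn e).antisymm (h.vertexAt_subset hn hm e.symm),
    fun e => (h'.vertexAt_subset hm hn e).antisymm (h'.vertexAt_subset hn hm e.symm)⟩

/-- The second condition on patterns, read geometrically: before an edge is crossed again, the walk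
has returned to the end at which it left that edge, so consecutive crossings have opposite
directions. -/
theorem IsClosedAcyclic.vertexAt_eq {s : Fin k → α} (hs : IsClosedAcyclic s) {i j : Fin k}
    (hij : i < j) (h : s i = s j) (hb : ∀ l, i < l → l < j → s l ≠ s i) :
    vertexAt s ((i : ℕ) + 1) = vertexAt s (j : ℕ) := by
  ext a
  rw [mem_vertexAt_iff_of_between s (by rw [Fin.lt_def] at hij; omega)]
  convert hs.2 i j hij h hb a using 5 <;> exact Iff.rfl

theorem IsClosedAcyclic.vertexAt_top {s : Fin k → α} (hs : IsClosedAcyclic s) :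
    vertexAt s k = ∅ := by
  ext a
  rw [mem_vertexAt_top]
  simpa using hs.1 a

theorem IsClosedAcyclic.even_length {s : Fin k → α} (hs : IsClosedAcyclic s) : Even k := by
  have h := Finset.card_eq_sum_card_fiberwise (f := s) (s := Finset.univ)
    (t := Finset.univ.image s)
    (fun x _ => Finset.mem_coe.2 (Finset.mem_image_of_mem s (Finset.mem_univ x)))
  rw [Finset.card_univ, Fintype.card_fin] at h
  rw [h]
  exact Finset.even_sum _ fun a _ => hs.1 a

theorem SamePattern.isClosedAcyclic {s : Fin k → α} {r : Fin k → β} (h : SamePattern s r)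
    (hs : IsClosedAcyclic s) : IsClosedAcyclic r := by
  have key : ∀ (P : Fin k → Prop),
      (∀ a, Even (Finset.univ.filter fun l => P l ∧ s l = a).card) →
      ∀ b, Even (Finset.univ.filter fun l => P l ∧ r l = b).card := by
    intro P hP b
    by_cases hb : ∃ l, r l = b
    · obtain ⟨l, rfl⟩ := hb
      have := hP (s l)
      simp only [h _ l] at this
      exact this
    · push Not at hb
      rw [Finset.filter_eq_empty_iff.2 (fun l _ hl => hb l hl.2)]
      simp
  constructor
  · intro b
    simpa using key (fun _ => True) (by simpa using hs.1) b
  · intro i j hij hr hb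
    have := key (fun l => i < l ∧ l < j) (by
      simpa [and_assoc] using hs.2 i j hij ((h i j).2 hr) fun l h1 h2 h3 =>
        hb l h1 h2 ((h l i).1 h3))
    simpa [and_assoc] using this

theorem exists_samePattern_fin (s : Fin k → α) : ∃ r : Fin k → Fin k, SamePattern s r := by
  choose f hf using fun a : Set.range s => a.2
  -- The new letter for a symbol is a chosen position at which it occurs.
  refine ⟨fun i => f ⟨s i, i, rfl⟩, fun i j => ⟨fun h => by simp [h], fun h => ?_⟩⟩
  have h1 := hf ⟨s i, i, rfl⟩
  have h2 := hf ⟨s j, j, rfl⟩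
  simp only at h1 h2 h
  rw [← h1, ← h2, h]

end Strings

/-! ### Walks from a tree-like vertex and their count by pattern -/

section Walks

variable {V : Type*}

/-- The string of edges traversed by a walk of length `k`. -/
def edgeString (k : ℕ) (p : ℕ → V) (i : Fin k) : Sym2 V := s(p i, p (i + 1))

variable {k : ℕ}

theorem edgeString_update {p : ℕ → V} {t : ℕ} (u : V) {i : Fin k} (hi : (i : ℕ) < t) :
    edgeString k (Function.update p (t + 1) u) i = edgeString k p i := by
  simp only [edgeString]
  rw [Function.update_of_ne (by omega), Function.update_of_ne (by omega)]

theorem edgeString_update_self {p : ℕ → V} (u : V) (i : Fin k) :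
    edgeString k (Function.update p ((i : ℕ) + 1) u) i = s(p i, u) := by
  simp only [edgeString]
  rw [Function.update_of_ne (by omega), Function.update_self]

/-- This isolates the condition on the newly chosen vertex `u`, so that walks with a given pattern
can be counted one step at a time. -/
theorem samePrefix_succ {α : Type*} {s : Fin k → α} {p : ℕ → V} (i : Fin k) (u : V) :
    SamePrefix ((i : ℕ) + 1) (edgeString k (Function.update p ((i : ℕ) + 1) u)) s ↔
      SamePrefix i (edgeString k p) s ∧ ∀ j < i, (edgeString k p j = s(p i, u) ↔ s j = s i) := by
  constructor
  · intro h
    refine ⟨fun a b ha hb => ?_, fun j hj => ?_⟩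
    · rw [← h a b (by omega) (by omega), edgeString_update u ha, edgeString_update u hb]
    · have hj' : (j : ℕ) < i := hj
      rw [← h j i (by omega) (by omega), edgeString_update u hj', edgeString_update_self]
  · rintro ⟨h1, h2⟩ a b ha hb
    rcases Nat.lt_succ_iff_lt_or_eq.1 ha with ha | ha
    · rw [edgeString_update u ha]
      rcases Nat.lt_succ_iff_lt_or_eq.1 hb with hb | hb
      · rw [edgeString_update u hb]
        exact h1 a b ha hb
      · obtain rfl := Fin.ext hb
        rw [edgeString_update_self]
        exact h2 a ha
    · obtain rfl := Fin.ext ha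
      rcases Nat.lt_succ_iff_lt_or_eq.1 hb with hb | hb
      · rw [edgeString_update_self, edgeString_update u hb, eq_comm, h2 b hb, eq_comm]
      · obtain rfl := Fin.ext hb
        simp

variable [Fintype V]

/-- The walks of length `t` in `G` starting at `v`, as sequences that are constantly `v` after
time `t`. -/
def walks (G : SimpleGraph V) (v : V) : ℕ → Finset (ℕ → V)
  | 0 => {fun _ => v}
  | t + 1 => (walks G v t).biUnion fun p =>
      (G.neighborFinset (p t)).image fun u => Function.update p (t + 1) u

theorem mem_walks {G : SimpleGraph V} {v : V} {t : ℕ} {p : ℕ → V} :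
    p ∈ walks G v t ↔ p 0 = v ∧ (∀ i < t, G.Adj (p i) (p (i + 1))) ∧ ∀ i > t, p i = v := by
  induction t generalizing p with
  | zero =>
    simp only [walks, Finset.mem_singleton]
    constructor
    · rintro rfl
      simp
    · rintro ⟨h0, -, h⟩
      ext i
      rcases Nat.eq_zero_or_pos i with rfl | hi
      · exact h0
      · exact h i hi
  | succ t ih =>
    simp only [walks, Finset.mem_biUnion, Finset.mem_image, SimpleGraph.mem_neighborFinset, ih]
    constructor
    · rintro ⟨q, ⟨h0, h1, h2⟩, u, hu, rfl⟩
      refine ⟨by simp [Function.update, h0], fun i hi => ?_, fun i hi => ?_⟩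
      · rcases Nat.lt_succ_iff_lt_or_eq.1 hi with h | rfl
        · rw [Function.update_of_ne (by omega), Function.update_of_ne (by omega)]
          exact h1 i h
        · rw [Function.update_of_ne (by omega), Function.update_self]
          exact hu
      · rw [Function.update_of_ne (by omega)]
        exact h2 i (by omega)
    · rintro ⟨h0, h1, h2⟩
      refine ⟨Function.update p (t + 1) v, ⟨?_, fun i hi => ?_, fun i hi => ?_⟩, p (t + 1), ?_, ?_⟩
      · simp [Function.update, h0]
      · rw [Function.update_of_ne (by omega), Function.update_of_ne (by omega)]
        exact h1 i (by omega)
      · by_cases hi' : i = t + 1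
        · simp [hi']
        · rw [Function.update_of_ne hi']
          exact h2 i (by omega)
      · rw [Function.update_of_ne (by omega)]
        exact h1 t (by omega)
      · simp

theorem sum_walks_succ {M : Type*} [AddCommMonoid M] (G : SimpleGraph V) (v : V) (t : ℕ)
    (f : (ℕ → V) → M) :
    ∑ p ∈ walks G v (t + 1), f p =
      ∑ p ∈ walks G v t, ∑ u ∈ G.neighborFinset (p t), f (Function.update p (t + 1) u) := by
  rw [walks, Finset.sum_biUnion]
  · refine Finset.sum_congr rfl fun p _ => Finset.sum_image fun u _ u' _ h => ?_
    simpa using congrFun h (t + 1)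
  · intro p hp q hq hpq
    rw [Function.onFun, Finset.disjoint_left]
    rintro r hr hr'
    obtain ⟨u, -, rfl⟩ := Finset.mem_image.1 hr
    obtain ⟨u', -, h⟩ := Finset.mem_image.1 hr'
    apply hpq
    -- At time `t + 1` both shorter walks have the default value `v`, so overwriting that entry
    -- loses no information.
    ext i
    by_cases hi : i = t + 1
    · rw [(mem_walks.1 hp).2.2 i (by omega), (mem_walks.1 hq).2.2 i (by omega)]
    · simpa [Function.update_of_ne hi] using (congrFun h i).symm

theorem card_walks {G : SimpleGraph V} {d : ℕ} (hG : ∀ v, (G.neighborFinset v).card = d) (v : V)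
    (t : ℕ) : (walks G v t).card = d ^ t := by
  induction t with
  | zero => simp [walks]
  | succ t ih =>
    rw [Finset.card_eq_sum_ones, sum_walks_succ]
    simp [hG, ih, pow_succ]

/-- A walk of length less than `k` that starts at `v` can be continued to a vertex it has visited
before only along an edge it has traversed before. -/
def IsTreeLikeAt (G : SimpleGraph V) (k : ℕ) (v : V) : Prop :=
  ∀ m < k, ∀ p ∈ walks G v m, ∀ j ≤ m, G.Adj (p m) (p j) →
    ∃ l < m, s(p l, p (l + 1)) = s(p m, p j)

variable {G : SimpleGraph V} {d : ℕ} {v : V}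

theorem IsTreeLikeAt.exists_edge (hv : IsTreeLikeAt G k v) {t : ℕ} (ht : t ≤ k) {p : ℕ → V}
    (hp : p ∈ walks G v t) {i j : ℕ} (hi : i < t) (hj : j ≤ i) (h : p (i + 1) = p j) :
    ∃ l < i, s(p l, p (l + 1)) = s(p i, p (i + 1)) := by
  obtain ⟨h0, h1, h2⟩ := mem_walks.1 hp
  -- Tree-likeness speaks of the last vertex of a walk, so `p` is cut off at time `i` and reset to
  -- the default value `v` afterwards.
  obtain ⟨l, hl, e⟩ := hv i (by omega) (fun l => if l ≤ i then p l else v) (mem_walks.2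
    ⟨by simp [h0], fun a ha => by
      simpa [show a ≤ i by omega, show a + 1 ≤ i by omega] using h1 a (by omega),
      fun a ha => by simp [show ¬ a ≤ i by omega]⟩) j hj (by
      simpa [hj, ← h] using h1 i hi)
  refine ⟨l, hl, ?_⟩
  simpa [hj, ← h, show l ≤ i by omega, show l + 1 ≤ i by omega] using e

/-- Around a tree-like vertex, the vertices of a walk correspond to the vertices of its diagram. -/
theorem IsTreeLikeAt.vertex_eq_iff (hv : IsTreeLikeAt G k v) {t : ℕ} (ht : t ≤ k) {p : ℕ → V}
    (hp : p ∈ walks G v t) {a b : ℕ} (ha : a ≤ t) (hb : b ≤ t) :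
    p a = p b ↔ vertexAt (edgeString k p) a = vertexAt (edgeString k p) b := by
  have key : ∀ c ≤ t, ∀ a ≤ c, ∀ b ≤ c,
      (p a = p b ↔ vertexAt (edgeString k p) a = vertexAt (edgeString k p) b) := by
    intro c
    induction c with
    | zero =>
      intro _ a ha b hb
      obtain rfl : a = 0 := by omega
      obtain rfl : b = 0 := by omega
      simp
    | succ c ih =>
      intro hc
      have ih := ih (by omega)
      suffices h : ∀ a ≤ c, (p (c + 1) = p a ↔
          vertexAt (edgeString k p) (c + 1) = vertexAt (edgeString k p) a) by
        intro a ha b hb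
        rcases Nat.le_succ_iff.1 ha with ha | rfl
        · rcases Nat.le_succ_iff.1 hb with hb | rfl
          · exact ih a ha b hb
          · rw [eq_comm, h a ha, eq_comm]
        · rcases Nat.le_succ_iff.1 hb with hb | rfl
          · exact h b hb
          · simp
      intro a ha
      let ci : Fin k := ⟨c, by omega⟩
      -- A repeated edge reduces the new endpoint to an earlier one, in the graph and in the diagram
      -- alike. A fresh edge leads to a new vertex in both: in the graph by tree-likeness, in the
      -- diagram because its symbol lies in no earlier vertex.
      by_cases hnew : ∃ l < c, s(p l, p (l + 1)) = s(p c, p (c + 1))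
      · obtain ⟨l, hl, e⟩ := hnew
        let li : Fin k := ⟨l, by omega⟩
        have es : edgeString k p li = edgeString k p ci := e
        rcases Sym2.eq_iff.1 e with ⟨e1, e2⟩ | ⟨e1, e2⟩
        · have hX := (ih l (by omega) c le_rfl).1 e1
          have := vertexAt_step_congr (edgeString k p) (i := li) (j := ci) es hX
          change vertexAt _ (l + 1) = vertexAt _ (c + 1) at this
          rw [← this, ← e2]
          exact ih (l + 1) (by omega) a ha
        · have hX := (ih (l + 1) (by omega) c le_rfl).1 e2
          have := vertexAt_step_back (edgeString k p) (i := li) (j := ci) es hX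
          change vertexAt _ (c + 1) = vertexAt _ l at this
          rw [this, ← e1]
          exact ih l (by omega) a ha
      · have hfirst : ∀ j, j < ci → edgeString k p j ≠ edgeString k p ci :=
          fun j hj e => hnew ⟨j, hj, e⟩
        refine iff_of_false (fun h => hnew (hv.exists_edge ht hp (by omega) ha h)) fun h => ?_
        have h1 : edgeString k p ci ∈ vertexAt (edgeString k p) ((ci : ℕ) + 1) := by
          rw [mem_vertexAt_succ]
          simpa using notMem_vertexAt (edgeString k p) hfirst le_rfl
        change _ ∈ vertexAt _ (c + 1) at h1
        rw [h] at h1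
        exact notMem_vertexAt (edgeString k p) hfirst ha h1
  exact key t le_rfl a ha b hb

theorem IsTreeLikeAt.isClosedAcyclic (hv : IsTreeLikeAt G k v) {p : ℕ → V}
    (hp : p ∈ walks G v k) (hc : p k = v) : IsClosedAcyclic (edgeString k p) := by
  have h0 : p k = p 0 := by rw [hc, (mem_walks.1 hp).1]
  constructor
  · intro a
    have h := (hv.vertex_eq_iff le_rfl hp le_rfl (Nat.zero_le k)).1 h0
    rw [← Nat.not_odd_iff_even, ← mem_vertexAt_top, h, vertexAt_zero]
    simp
  · intro i j hij e hb a
    have hij' : (i : ℕ) < j := hij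
    have hj := j.2
    have hX : vertexAt (edgeString k p) ((i : ℕ) + 1) = vertexAt (edgeString k p) (j : ℕ) := by
      rcases Sym2.eq_iff.1 (show s(p i, p (i + 1)) = s(p j, p (j + 1)) from e) with
        ⟨e1, -⟩ | ⟨-, e2⟩
      -- Two crossings in the same direction would give equal diagram vertices at times `i` and `j`,
      -- but the symbol occurs exactly once in the positions from `i` to `j - 1`.
      · exfalso
        have hX := (hv.vertex_eq_iff le_rfl hp (by omega) (by omega)).1 e1
        have hE := (mem_vertexAt_iff_of_between (edgeString k p) hij'.le
          (edgeString k p i)).1 (by rw [hX])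
        refine absurd hE ?_
        rw [Nat.not_even_iff_odd]
        convert odd_one
        rw [Finset.card_eq_one]
        refine ⟨i, ?_⟩
        ext l
        simp only [Finset.mem_filter, Finset.mem_univ, true_and, Finset.mem_singleton]
        constructor
        · rintro ⟨h1, h2, h3⟩
          by_contra hne
          exact hb l (lt_of_le_of_ne h1 (Ne.symm hne)) h2 h3
        · rintro rfl
          exact ⟨le_rfl, hij', rfl⟩
      · exact (hv.vertex_eq_iff le_rfl hp (by omega) (by omega)).1 e2
    have := (mem_vertexAt_iff_of_between (edgeString k p) (Nat.succ_le_of_lt hij') a).1 (by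
      rw [← hX])
    convert this using 5 <;> exact Iff.rfl

/-- At the first occurrence of a symbol, the neighbours reached along an edge that was used before
are counted by `alpha`. -/
theorem IsTreeLikeAt.card_used (hv : IsTreeLikeAt G k v) {α : Type*} {s : Fin k → α}
    {i : Fin k} (hi : IsFirst s i) {p : ℕ → V} (hp : p ∈ walks G v i)
    (hs : SamePrefix i (edgeString k p) s) :
    ((G.neighborFinset (p i)).filter fun u => ∃ j < i, edgeString k p j = s(p i, u)).card =
      alpha s i := by
  have hik := i.2
  have hadj : ∀ j < i, (EdgesAdjacent s j i ↔ p i ∈ edgeString k p j) := by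
    intro j hj
    have hj' : (j : ℕ) < i := hj
    have hsi : s i ∈ vertexAt s ((i : ℕ) + 1) := by
      rw [mem_vertexAt_succ]
      simpa using notMem_vertexAt s hi le_rfl
    -- The far end of the new edge is a new vertex, so an earlier edge can meet the new edge only at
    -- the current vertex.
    have hne : ∀ n ≤ (i : ℕ), vertexAt s n ≠ vertexAt s ((i : ℕ) + 1) := fun n hn e =>
      notMem_vertexAt s hi hn (e ▸ hsi)
    rw [edgesAdjacent_iff]
    simp only [hi j hj, ne_eq, not_false_eq_true, true_and, hne j hj'.le, hne (j + 1) hj',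
      or_false, edgeString, Sym2.mem_iff]
    rw [← hs.vertexAt_eq hj'.le le_rfl, ← hs.vertexAt_eq (Nat.succ_le_of_lt hj') le_rfl,
      ← hv.vertex_eq_iff hik.le hp hj'.le le_rfl,
      ← hv.vertex_eq_iff hik.le hp (Nat.succ_le_of_lt hj') le_rfl, eq_comm,
      @eq_comm _ (p (j + 1))]
  -- Both numbers count the used edges at `p i`: one by their other endpoint, the other by the first
  -- time of use.
  rw [alpha, ← Finset.card_image_of_injOn (f := fun u => s(p i, u)) (fun u _ u' _ h =>
    Sym2.congr_right.1 h), ← Finset.card_image_of_injOn (f := edgeString k p)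
    (s := (firsts s).filter fun j => j < i ∧ EdgesAdjacent s j i)]
  · congr 1
    ext e
    simp only [Finset.mem_image, Finset.mem_filter, SimpleGraph.mem_neighborFinset, firsts,
      Finset.mem_univ, true_and]
    constructor
    · rintro ⟨u, ⟨hu, j, hj, e1⟩, rfl⟩
      obtain ⟨l, hl, hmin⟩ : ∃ l, s l = s j ∧ ∀ l' < l, s l' ≠ s j := by
        have := Finset.exists_min_image (Finset.univ.filter fun l => s l = s j) id ⟨j, by simp⟩
        obtain ⟨l, hl, hm⟩ := this
        refine ⟨l, by simpa using hl, fun l' hl' h' => ?_⟩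
        exact absurd (hm l' (by simpa using h')) (by simpa using hl')
      have hlj : l ≤ j := by
        by_contra hlt
        exact hmin j (not_le.1 hlt) rfl
      have hli : l < i := hlj.trans_lt hj
      have e2 : edgeString k p l = s(p i, u) := by rw [← e1, hs l j hli hj, hl]
      refine ⟨l, ⟨fun l' hl' => by rw [hl]; exact hmin l' hl', hli, (hadj l hli).2 ?_⟩, e2⟩
      rw [e2]
      simp
    · rintro ⟨j, ⟨hj1, hj2, hj3⟩, rfl⟩
      have hj' : (j : ℕ) < i := hj2
      have hA := (mem_walks.1 hp).2.1 j hj'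
      rcases Sym2.mem_iff.1 ((hadj j hj2).1 hj3) with h | h
      · refine ⟨p (j + 1), ⟨h ▸ hA, j, hj2, ?_⟩, ?_⟩ <;> simp [edgeString, h]
      · refine ⟨p j, ⟨h ▸ hA.symm, j, hj2, ?_⟩, ?_⟩ <;> simp [edgeString, h, Sym2.eq_swap]
  · intro a ha b hb hab
    simp only [Finset.coe_filter, firsts, Finset.mem_filter, Finset.mem_univ, true_and,
      Set.mem_ofPred_eq] at ha hb
    have hsab := (hs a b ha.2.1 hb.2.1).1 hab
    rcases lt_trichotomy a b with h | h | h
    · exact absurd hsab (hb.1 a h)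
    · exact h
    · exact absurd hsab.symm (ha.1 b h)

/-- The number of ways to continue a walk whose edges follow the pattern of a string so far. -/
theorem IsTreeLikeAt.card_continuations (hv : IsTreeLikeAt G k v)
    (hG : ∀ v, (G.neighborFinset v).card = d) {α : Type*} {s : Fin k → α}
    (hca : IsClosedAcyclic s) (i : Fin k) {p : ℕ → V} (hp : p ∈ walks G v i)
    (hs : SamePrefix i (edgeString k p) s) :
    (((G.neighborFinset (p i)).filter fun u =>
      ∀ j < i, (edgeString k p j = s(p i, u) ↔ s j = s i)).card : ℝ) =
      if i ∈ firsts s then (d : ℝ) - alpha s i else 1 := by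
  split_ifs with hi
  · have hi : IsFirst s i := by simpa [firsts] using hi
    have h1 := Finset.card_filter_add_card_filter_not (s := G.neighborFinset (p i))
      (fun u => ∃ j < i, edgeString k p j = s(p i, u))
    rw [hv.card_used hi hp hs, hG] at h1
    rw [← h1]
    push_cast
    rw [add_sub_cancel_left]
    congr 2
    ext u
    simp only [Finset.mem_filter, and_congr_right_iff]
    intro _
    push Not
    exact forall₂_congr fun j hj => by simp [hi j hj]
  · have hex : ∃ j, j < i ∧ s j = s i := by simpa [firsts, IsFirst] using hi
    -- Take the latest earlier occurrence `j`. The walk is now back at `p (j + 1)`, so the only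
    -- admissible continuation is to `p j`.
    obtain ⟨j, hj, hmax⟩ := Finset.exists_max_image
      (Finset.univ.filter fun j => j < i ∧ s j = s i) id (by simpa [Finset.Nonempty] using hex)
    obtain ⟨hji, hjs⟩ : j < i ∧ s j = s i := by simpa using hj
    have hji' : (j : ℕ) < i := hji
    have hik := i.2
    have hX := hca.vertexAt_eq hji hjs fun l h1 h2 h3 =>
      absurd (hmax l (by simpa using ⟨h2, h3.trans hjs⟩)) (by simpa using h1)
    rw [← hs.vertexAt_eq hji' le_rfl, ← hv.vertex_eq_iff hik.le hp hji' le_rfl] at hX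
    have hA := (mem_walks.1 hp).2.1 j hji'
    rw [Nat.cast_eq_one, Finset.card_eq_one]
    refine ⟨p j, ?_⟩
    ext u
    simp only [Finset.mem_filter, SimpleGraph.mem_neighborFinset, Finset.mem_singleton]
    constructor
    · rintro ⟨-, hu⟩
      have := (hu j hji).2 hjs
      rw [edgeString, hX, Sym2.eq_swap] at this
      exact (Sym2.congr_right.1 this).symm
    · rintro rfl
      refine ⟨hX ▸ hA.symm, fun l hl => ?_⟩
      rw [← hjs, ← hs l j hl hji, ← hX, Sym2.eq_swap]
      rfl

/-- The number of continuations is the same for every matching prefix, so the counts multiply. If no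
prefix matches, the product is already zero, and a later negative factor does no harm. -/
theorem IsTreeLikeAt.card_samePrefix (hv : IsTreeLikeAt G k v)
    (hG : ∀ v, (G.neighborFinset v).card = d) {α : Type*} {s : Fin k → α}
    (hca : IsClosedAcyclic s) {t : ℕ} (ht : t ≤ k) :
    (((walks G v t).filter fun p => SamePrefix t (edgeString k p) s).card : ℝ) =
      ∏ i ∈ (firsts s).filter (fun i : Fin k => (i : ℕ) < t), ((d : ℝ) - alpha s i) := by
  induction t with
  | zero => simp [walks, SamePrefix]
  | succ t ih =>
    let i : Fin k := ⟨t, ht⟩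
    have ih := ih (by omega)
    have hstep : (((walks G v (t + 1)).filter
        fun p => SamePrefix (t + 1) (edgeString k p) s).card : ℝ) =
        ∑ p ∈ (walks G v t).filter fun p => SamePrefix t (edgeString k p) s,
          if i ∈ firsts s then (d : ℝ) - alpha s i else 1 := by
      rw [Finset.card_filter, sum_walks_succ, Finset.sum_filter]
      push_cast
      refine Finset.sum_congr rfl fun p hp => ?_
      have hiff : ∀ u, SamePrefix (t + 1) (edgeString k (Function.update p (t + 1) u)) s ↔ _ :=
        fun u => samePrefix_succ i u
      simp only [hiff]
      change _ = if SamePrefix (i : ℕ) (edgeString k p) s then _ else _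
      by_cases h : SamePrefix (i : ℕ) (edgeString k p) s
      · rw [if_pos h, ← hv.card_continuations hG hca i hp h, Finset.card_filter]
        push_cast
        exact Finset.sum_congr rfl fun u _ => by simp [h, i]
      · simp [h]
    rw [hstep, Finset.sum_const, nsmul_eq_mul, ih]
    split_ifs with hi
    · rw [show (firsts s).filter (fun j : Fin k => (j : ℕ) < t + 1) =
        insert i ((firsts s).filter fun j : Fin k => (j : ℕ) < t) from ?_,
        Finset.prod_insert (by simp [i]), mul_comm]
      ext j
      simp only [Finset.mem_filter, Finset.mem_insert, Fin.ext_iff]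
      constructor
      · rintro ⟨h1, h2⟩
        by_cases h3 : (j : ℕ) = t
        · exact Or.inl h3
        · exact Or.inr ⟨h1, by omega⟩
      · rintro (h | h)
        · exact ⟨by rwa [show j = i from Fin.ext h], by rw [h]; simp [i]⟩
        · exact ⟨h.1, by omega⟩
    · rw [mul_one]
      congr 1
      ext j
      simp only [Finset.mem_filter, and_congr_right_iff]
      intro hj
      have : (j : ℕ) ≠ t := fun h => hi (by rwa [show i = j from Fin.ext h.symm])
      omega

/-- Around a tree-like vertex of a regular graph, the number of walks that follow a closed acyclic
string is its multiplicity; all of them are closed. -/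
theorem IsTreeLikeAt.card_samePattern (hv : IsTreeLikeAt G k v)
    (hG : ∀ v, (G.neighborFinset v).card = d) {α : Type*} {s : Fin k → α}
    (hca : IsClosedAcyclic s) :
    (((walks G v k).filter fun p => p k = v ∧ SamePattern (edgeString k p) s).card : ℝ) =
      stringMultiplicity s d := by
  have h := hv.card_samePrefix hG hca le_rfl
  rw [Finset.filter_true_of_mem (s := firsts s) (fun i _ => Fin.is_lt i)] at h
  rw [stringMultiplicity, ← h]
  congr 2
  refine Finset.filter_congr fun p hp => ?_
  rw [samePrefix_top]
  refine ⟨fun h => h.2, fun h => ⟨?_, h⟩⟩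
  rw [← (mem_walks.1 hp).1, hv.vertex_eq_iff le_rfl hp le_rfl (Nat.zero_le k), h.vertexAt_eq,
    hca.vertexAt_top, vertexAt_zero]

end Walks

/-! ### Edge switching and the rarity of vertices that are not tree-like -/

section Switching

variable {V : Type*}

/-- The edges that are exchanged in switching `ab` and `xy` to `ax` and `by`. -/
def switchSet (a b x y : V) : Set (Sym2 V) := {s(a, b), s(x, y), s(a, x), s(b, y)}

/-- The graph obtained by switching the edges `ab` and `xy` to `ax` and `by`. -/
def switch (G : SimpleGraph V) (a b x y : V) : SimpleGraph V :=
  SimpleGraph.fromEdgeSet (symmDiff G.edgeSet (switchSet a b x y))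

theorem switchSet_swap (a b x y : V) : switchSet b a y x = switchSet a b x y := by
  ext e
  simp only [switchSet, Set.mem_insert_iff, Set.mem_singleton_iff, Sym2.eq_swap (a := b) (b := a),
    Sym2.eq_swap (a := y) (b := x)]
  tauto

theorem switchSet_exchange (a b x y : V) : switchSet x y a b = switchSet a b x y := by
  ext e
  simp only [switchSet, Set.mem_insert_iff, Set.mem_singleton_iff, Sym2.eq_swap (a := x) (b := a),
    Sym2.eq_swap (a := y) (b := b)]
  tauto

/-- The conditions under which the edges `ab` and `xy` can be switched to `ax` and `by`. -/
structure Switchable (G : SimpleGraph V) (a b x y : V) : Prop where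
  adj : G.Adj a b
  adj' : G.Adj x y
  ax : a ≠ x
  ay : a ≠ y
  bx : b ≠ x
  not_eq : b ≠ y
  not_adj : ¬ G.Adj a x
  not_adj' : ¬ G.Adj b y

namespace Switchable

variable {G : SimpleGraph V} {a b x y : V}

theorem swap (h : Switchable G a b x y) : Switchable G b a y x :=
  ⟨h.adj.symm, h.adj'.symm, h.not_eq, h.bx, h.ay, h.ax, h.not_adj', h.not_adj⟩

theorem exchange (h : Switchable G a b x y) : Switchable G x y a b :=
  ⟨h.adj', h.adj, h.ax.symm, h.bx.symm, h.ay.symm, h.not_eq.symm, fun e => h.not_adj e.symm,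
    fun e => h.not_adj' e.symm⟩

theorem edgeSet_switch (h : Switchable G a b x y) :
    (switch G a b x y).edgeSet = symmDiff G.edgeSet (switchSet a b x y) := by
  rw [switch, SimpleGraph.edgeSet_fromEdgeSet, sdiff_eq_left, Set.disjoint_left]
  rintro e (⟨he, -⟩ | ⟨he, -⟩)
  · exact G.not_isDiag_of_mem_edgeSet he
  · simp only [switchSet, Set.mem_insert_iff, Set.mem_singleton_iff] at he
    rcases he with rfl | rfl | rfl | rfl
    · simpa using h.adj.ne
    · simpa using h.adj'.ne
    · simpa using h.ax
    · simpa using h.not_eq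

theorem switch_adj (h : Switchable G a b x y) (u w : V) :
    (switch G a b x y).Adj u w ↔ ¬ (G.Adj u w ↔ s(u, w) ∈ switchSet a b x y) := by
  rw [← SimpleGraph.mem_edgeSet, h.edgeSet_switch, Set.mem_symmDiff, SimpleGraph.mem_edgeSet]
  tauto

/-- Switching is undone by the same symmetric difference. This makes the switching map injective
once `a`, `b`, `x`, `y` are known. -/
theorem edgeSet_eq (h : Switchable G a b x y) :
    G.edgeSet = symmDiff (switch G a b x y).edgeSet (switchSet a b x y) := by
  rw [h.edgeSet_switch, symmDiff_symmDiff_cancel_right]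

variable [Fintype V]

theorem card_neighborFinset_left (h : Switchable G a b x y) :
    ((switch G a b x y).neighborFinset a).card = (G.neighborFinset a).card := by
  have : (switch G a b x y).neighborFinset a = insert x ((G.neighborFinset a).erase b) := by
    ext w
    simp only [SimpleGraph.mem_neighborFinset, h.switch_adj, switchSet, Set.mem_insert_iff,
      Set.mem_singleton_iff, Sym2.eq_iff, Finset.mem_insert, Finset.mem_erase]
    have := h.adj
    have := h.not_adj
    have := h.ax
    have := h.ay
    have := h.bx
    have := h.adj.ne
    by_cases hb : w = b
    · subst hb
      simp [*]
    · by_cases hx : w = x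
      · subst hx
        simp [*]
      · simp [*]
  rw [this, Finset.card_insert_of_notMem (by simp [h.not_adj]), Finset.card_erase_add_one]
  simpa using h.adj

theorem card_neighborFinset (h : Switchable G a b x y) (u : V) :
    ((switch G a b x y).neighborFinset u).card = (G.neighborFinset u).card := by
  -- The symmetries of the switching carry each of its four vertices to the first place.
  have hb : switch G b a y x = switch G a b x y := by rw [switch, switch, switchSet_swap]
  have hx : switch G x y a b = switch G a b x y := by rw [switch, switch, switchSet_exchange]
  have hy : switch G y x b a = switch G a b x y := by rw [switch, switchSet_swap, ← switch, hx]
  by_cases h1 : u = a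
  · exact h1 ▸ h.card_neighborFinset_left
  by_cases h2 : u = b
  · rw [← hb]
    exact h2 ▸ h.swap.card_neighborFinset_left
  by_cases h3 : u = x
  · rw [← hx]
    exact h3 ▸ h.exchange.card_neighborFinset_left
  by_cases h4 : u = y
  · rw [← hy]
    exact h4 ▸ h.exchange.swap.card_neighborFinset_left
  congr 1
  ext w
  simp [h.switch_adj, switchSet, h1, h2, h3, h4]

end Switchable

variable [Fintype V]

theorem card_sigma_neighborFinset {G : SimpleGraph V} {d : ℕ}
    (hG : ∀ v, (G.neighborFinset v).card = d) (S : Finset V) :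
    (S.sigma fun x => G.neighborFinset x).card = S.card * d := by
  simp [Finset.card_sigma, hG]

/-- The darts `xy` that can be switched with an edge between two vertices of the walk `p`, keeping
the walk. -/
def farDarts (G : SimpleGraph V) (p : ℕ → V) (m j : ℕ) : Finset (Σ _ : V, V) :=
  (Finset.univ.sigma fun x => G.neighborFinset x).filter fun q =>
    q.1 ∉ (Finset.range (m + 1)).image p ∪ G.neighborFinset (p m) ∧
      q.2 ∉ (Finset.range (m + 1)).image p ∪ G.neighborFinset (p j)

/-- Each end of a dart has to avoid at most `m + 1` visited vertices and `d` neighbours, and each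
forbidden vertex rules out `d` darts. -/
theorem card_farDarts {G : SimpleGraph V} {d : ℕ} (hG : ∀ v, (G.neighborFinset v).card = d)
    (p : ℕ → V) (m j : ℕ) :
    Fintype.card V * d ≤ (farDarts G p m j).card + 2 * (m + 1 + d) * d := by
  set S : ℕ → Finset V := fun l => (Finset.range (m + 1)).image p ∪ G.neighborFinset (p l)
  have hS : ∀ l, ((S l).sigma fun x => G.neighborFinset x).card ≤ (m + 1 + d) * d := by
    intro l
    rw [card_sigma_neighborFinset hG]
    refine Nat.mul_le_mul_right _ ((Finset.card_union_le _ _).trans ?_)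
    rw [hG]
    exact Nat.add_le_add_right (Finset.card_image_le.trans (by simp)) _
  rw [← Finset.card_univ, ← card_sigma_neighborFinset hG]
  have hsub : (Finset.univ.sigma fun x => G.neighborFinset x) ⊆ farDarts G p m j ∪
      (((S m).sigma fun x => G.neighborFinset x) ∪
        ((S j).sigma fun x => G.neighborFinset x).image fun q => ⟨q.2, q.1⟩) := by
    rintro ⟨x, y⟩ h
    have hxy : G.Adj x y := by simpa using h
    by_cases h1 : x ∈ S m
    · exact Finset.mem_union_right _ (Finset.mem_union_left _ (by simp [h1, hxy]))
    by_cases h2 : y ∈ S j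
    · exact Finset.mem_union_right _ (Finset.mem_union_right _ (Finset.mem_image.2
        ⟨⟨y, x⟩, by simp [h2, hxy.symm], rfl⟩))
    · exact Finset.mem_union_left _ (Finset.mem_filter.2 ⟨h, h1, h2⟩)
  refine (Finset.card_le_card hsub).trans ((Finset.card_union_le _ _).trans ?_)
  refine Nat.add_le_add_left ((Finset.card_union_le _ _).trans ?_) _
  have := Finset.card_image_le (s := (S j).sigma fun x => G.neighborFinset x)
    (f := fun q => (⟨q.2, q.1⟩ : Σ _ : V, V))
  linarith [hS m, hS j]

/-- The walks of length `m` from `v` whose last vertex is joined to the one visited at time `j` by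
an edge that the walk has not traversed. -/
def returns (G : SimpleGraph V) (v : V) (m j : ℕ) : Finset (ℕ → V) :=
  (walks G v m).filter fun p =>
    G.Adj (p m) (p j) ∧ ∀ l < m, s(p l, p (l + 1)) ≠ s(p m, p j)

theorem switchable_of_mem_farDarts {G : SimpleGraph V} {v : V} {m j : ℕ} (hj : j ≤ m)
    {p : ℕ → V} (hp : p ∈ returns G v m j) {x y : V} (hxy : ⟨x, y⟩ ∈ farDarts G p m j) :
    Switchable G (p m) (p j) x y := by
  simp only [farDarts, Finset.mem_filter, Finset.mem_sigma, Finset.mem_univ, true_and,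
    SimpleGraph.mem_neighborFinset, Finset.mem_union, Finset.mem_image, Finset.mem_range,
    not_or, not_exists, not_and] at hxy
  obtain ⟨h1, ⟨h2, h3⟩, h4, h5⟩ := hxy
  exact ⟨(Finset.mem_filter.1 hp).2.1, h1, h2 m (by omega), h4 m (by omega), h2 j (by omega),
    h4 j (by omega), h3, h5⟩

/-- The removed edge joining `p m` to `p j` was never traversed, and the other three exchanged edges
contain `x` or `y`, which the walk avoids. -/
theorem mem_walks_switch {G : SimpleGraph V} {v : V} {m j : ℕ} (hj : j ≤ m)
    {p : ℕ → V} (hp : p ∈ returns G v m j) {x y : V} (hxy : ⟨x, y⟩ ∈ farDarts G p m j) :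
    p ∈ walks (switch G (p m) (p j) x y) v m := by
  have h := switchable_of_mem_farDarts hj hp hxy
  obtain ⟨hw, hadj, hne⟩ := Finset.mem_filter.1 hp
  obtain ⟨h0, h1, h2⟩ := mem_walks.1 hw
  simp only [farDarts, Finset.mem_filter, Finset.mem_sigma, Finset.mem_univ, true_and,
    SimpleGraph.mem_neighborFinset, Finset.mem_union, Finset.mem_image, Finset.mem_range,
    not_or, not_exists, not_and] at hxy
  obtain ⟨-, ⟨hx, -⟩, hy, -⟩ := hxy
  refine mem_walks.2 ⟨h0, fun l hl => ?_, h2⟩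
  rw [h.switch_adj]
  have hx1 := hx l (by omega)
  have hx2 := hx (l + 1) (by omega)
  have hy1 := hy l (by omega)
  have hy2 := hy (l + 1) (by omega)
  have := hne l hl
  rw [Ne, Sym2.eq_iff] at this
  simp [h1 l hl, switchSet, hx1, hx2, hy1, hy2, this]

/-- Double counting: a graph, a returning walk and a far dart `xy` are sent to the switched graph
with the same walk and dart. In the image `x` is a neighbour of `p m` and `y` of `p j`, which leaves
`d ^ m * d * d` choices per graph, whereas almost all of the `d * |V|` darts are available in the
source. -/
theorem sum_card_returns_le (v : V) (d : ℕ) {m j : ℕ} (hj : j ≤ m)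
    (R : Finset (SimpleGraph V)) (hR : ∀ G, G ∈ R ↔ ∀ v, (G.neighborFinset v).card = d) :
    (∑ G ∈ R, (returns G v m j).card) * (Fintype.card V * d) ≤
      R.card * d ^ (m + 2) + (∑ G ∈ R, (returns G v m j).card) * (2 * (m + 1 + d) * d) := by
  let A : Finset (Σ _ : SimpleGraph V, Σ _ : ℕ → V, Σ _ : V, V) :=
    R.sigma fun G => (returns G v m j).sigma fun p => farDarts G p m j
  let B : Finset (Σ _ : SimpleGraph V, Σ _ : ℕ → V, Σ _ : V, V) :=
    R.sigma fun G => (walks G v m).sigma fun p =>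
      (G.neighborFinset (p m)).sigma fun _ => G.neighborFinset (p j)
  have hB : B.card = R.card * d ^ (m + 2) := by
    simp only [B, Finset.card_sigma]
    rw [← smul_eq_mul, ← Finset.sum_const]
    refine Finset.sum_congr rfl fun G hG => ?_
    have hG := (hR G).1 hG
    simp [hG, card_walks hG]
    ring
  have hAB : A.card ≤ B.card := by
    refine Finset.card_le_card_of_injOn
      (fun q => ⟨switch q.1 (q.2.1 m) (q.2.1 j) q.2.2.1 q.2.2.2, q.2⟩) ?_ ?_
    · rintro ⟨G, p, x, y⟩ hq
      obtain ⟨hG, hp, hxy⟩ : G ∈ R ∧ p ∈ returns G v m j ∧ ⟨x, y⟩ ∈ farDarts G p m j := by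
        simpa [A] using hq
      have h := switchable_of_mem_farDarts hj hp hxy
      simp only [B, Finset.mem_coe, Finset.mem_sigma, SimpleGraph.mem_neighborFinset]
      refine ⟨(hR _).2 fun u => ?_, mem_walks_switch hj hp hxy, ?_, ?_⟩
      · rw [h.card_neighborFinset, (hR G).1 hG]
      · rw [h.switch_adj]
        simp [h.not_adj, switchSet]
      · rw [h.switch_adj]
        simp [h.not_adj', switchSet]
    · rintro ⟨G, p, x, y⟩ hq ⟨G', p', x', y'⟩ hq' e
      obtain ⟨hG, hp, hxy⟩ : G ∈ R ∧ p ∈ returns G v m j ∧ ⟨x, y⟩ ∈ farDarts G p m j := by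
        simpa [A] using hq
      obtain ⟨hG', hp', hxy'⟩ : G' ∈ R ∧ p' ∈ returns G' v m j ∧
          ⟨x', y'⟩ ∈ farDarts G' p' m j := by
        simpa [A] using hq'
      simp only [Sigma.mk.injEq, heq_eq_eq] at e
      obtain ⟨e1, rfl, rfl, rfl⟩ := e
      have h := switchable_of_mem_farDarts hj hp hxy
      have h' := switchable_of_mem_farDarts hj hp' hxy'
      have : G = G' := by
        rw [← SimpleGraph.edgeSet_inj, h.edgeSet_eq, h'.edgeSet_eq, e1]
      rw [this]
  calc (∑ G ∈ R, (returns G v m j).card) * (Fintype.card V * d)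
      = ∑ G ∈ R, ∑ p ∈ returns G v m j, Fintype.card V * d := by
        simp [Finset.sum_mul]
    _ ≤ ∑ G ∈ R, ∑ p ∈ returns G v m j,
          ((farDarts G p m j).card + 2 * (m + 1 + d) * d) :=
        Finset.sum_le_sum fun G hG => Finset.sum_le_sum fun p _ => card_farDarts ((hR G).1 hG) p m j
    _ = A.card + (∑ G ∈ R, (returns G v m j).card) * (2 * (m + 1 + d) * d) := by
        simp only [A, Finset.card_sigma, Finset.sum_add_distrib, Finset.sum_mul,
          Finset.sum_const, smul_eq_mul]
    _ ≤ _ := by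
        rw [← hB]
        exact Nat.add_le_add_right hAB _

theorem exists_returns_of_not_isTreeLikeAt {G : SimpleGraph V} {k : ℕ} {v : V}
    (h : ¬ IsTreeLikeAt G k v) : ∃ m < k, ∃ j ≤ m, (returns G v m j).Nonempty := by
  simp only [IsTreeLikeAt, not_forall, not_exists, not_and] at h
  obtain ⟨m, hm, p, hp, j, hj, hadj, hne⟩ := h
  exact ⟨m, hm, j, hj, p, Finset.mem_filter.2 ⟨hp, hadj, hne⟩⟩

/-- The number of regular graphs that are not tree-like at a given vertex is `O(|R| / |V|)`. -/
theorem card_not_isTreeLikeAt_le (v : V) (d k : ℕ)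
    (R : Finset (SimpleGraph V)) (hR : ∀ G, G ∈ R ↔ ∀ v, (G.neighborFinset v).card = d)
    (hV : 4 * (k + 1 + d) ≤ Fintype.card V) :
    ((R.filter fun G => ¬ IsTreeLikeAt G k v).card : ℝ) * Fintype.card V ≤
      R.card * (2 * k ^ 2 * (d + 1) ^ (k + 2)) := by
  have hret : ∀ m < k, ∀ j ≤ m, ((∑ G ∈ R, (returns G v m j).card : ℕ) : ℝ) * Fintype.card V ≤
      R.card * (2 * (d + 1) ^ (k + 2)) := by
    intro m hm j hj
    -- The switching estimate carries a factor `d` on the left, which can be dropped only if `d` is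
    -- positive; for `d = 0` there are no edges to return along.
    rcases Nat.eq_zero_or_pos d with rfl | hd
    · have : ∑ G ∈ R, (returns G v m j).card = 0 := by
        refine Finset.sum_eq_zero fun G hG => ?_
        rw [Finset.card_eq_zero, returns, Finset.filter_eq_empty_iff]
        rintro p - ⟨h, -⟩
        have := (hR G).1 hG (p m)
        rw [Finset.card_eq_zero] at this
        have h' : p j ∈ G.neighborFinset (p m) := by simpa using h
        rw [this] at h'
        simp at h'
      rw [this]
      simp only [CharP.cast_eq_zero, zero_mul]
      positivity
    · have h := sum_card_returns_le v d hj R hR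
      set X := ∑ G ∈ R, (returns G v m j).card
      -- The lower bound on `|V|` makes the unavailable darts at most half of all darts, whence the
      -- factor 2 in the final bound.
      have h2 : X * (2 * (m + 1 + d) * d) * 2 ≤ X * (Fintype.card V * d) := by
        have : 2 * (m + 1 + d) * 2 ≤ Fintype.card V := by omega
        calc X * (2 * (m + 1 + d) * d) * 2 = X * (2 * (m + 1 + d) * 2 * d) := by ring
          _ ≤ _ := by gcongr
      have h3 : X * Fintype.card V ≤ R.card * (2 * (d + 1) ^ (k + 2)) := by
        calc X * Fintype.card V ≤ X * (Fintype.card V * d) := by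
              gcongr
              exact Nat.le_mul_of_pos_right _ hd
          _ ≤ R.card * (2 * d ^ (m + 2)) := by linarith
          _ ≤ R.card * (2 * (d + 1) ^ (m + 2)) := by gcongr; omega
          _ ≤ _ := by
              gcongr
              · omega
      exact_mod_cast h3
  have hle : (R.filter fun G => ¬ IsTreeLikeAt G k v).card ≤
      ∑ m ∈ Finset.range k, ∑ j ∈ Finset.range (m + 1), ∑ G ∈ R, (returns G v m j).card := by
    rw [Finset.card_filter]
    simp_rw [Finset.sum_comm (t := R)]
    refine Finset.sum_le_sum fun G _ => ?_
    split_ifs with h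
    · exact Nat.zero_le _
    · obtain ⟨m, hm, j, hj, hne⟩ := exists_returns_of_not_isTreeLikeAt h
      calc 1 ≤ (returns G v m j).card := hne.card_pos
        _ ≤ ∑ j ∈ Finset.range (m + 1), (returns G v m j).card :=
          Finset.single_le_sum (f := fun j => (returns G v m j).card)
            (fun _ _ => Nat.zero_le _) (Finset.mem_range.2 (by omega))
        _ ≤ _ := Finset.single_le_sum
            (f := fun m => ∑ j ∈ Finset.range (m + 1), (returns G v m j).card)
            (fun _ _ => Nat.zero_le _) (Finset.mem_range.2 hm)
  calc ((R.filter fun G => ¬ IsTreeLikeAt G k v).card : ℝ) * Fintype.card V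
      ≤ ((∑ m ∈ Finset.range k, ∑ j ∈ Finset.range (m + 1),
          ∑ G ∈ R, (returns G v m j).card : ℕ) : ℝ) * Fintype.card V := by
        gcongr
    _ = ∑ m ∈ Finset.range k, ∑ j ∈ Finset.range (m + 1),
          ((∑ G ∈ R, (returns G v m j).card : ℕ) : ℝ) * Fintype.card V := by
        push_cast
        simp only [Finset.sum_mul]
    _ ≤ ∑ m ∈ Finset.range k, ∑ j ∈ Finset.range (m + 1),
          (R.card * (2 * (d + 1) ^ (k + 2)) : ℝ) :=
        Finset.sum_le_sum fun m hm => Finset.sum_le_sum fun j hj =>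
          hret m (Finset.mem_range.1 hm) j (by have := Finset.mem_range.1 hj; omega)
    _ ≤ ∑ m ∈ Finset.range k, (k : ℝ) * (R.card * (2 * (d + 1) ^ (k + 2))) := by
        refine Finset.sum_le_sum fun m hm => ?_
        rw [Finset.sum_const, Finset.card_range, nsmul_eq_mul]
        have : ((m + 1 : ℕ) : ℝ) ≤ k := by exact_mod_cast Finset.mem_range.1 hm
        gcongr
    _ = _ := by
        rw [Finset.sum_const, Finset.card_range, nsmul_eq_mul]
        ring

end Switching

/-! ### Existence of regular graphs: circulant graphs -/

section Existence

theorem mem_regularGraphs {N d : ℕ} {G : SimpleGraph (Fin N)} :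
    G ∈ regularGraphs N d ↔ ∀ v, (G.neighborFinset v).card = d := by
  refine Finset.mem_filter.trans ((and_iff_right (Finset.mem_univ G)).trans ?_)
  exact forall_congr' fun v => by rw [SimpleGraph.card_neighborFinset_eq_degree]

theorem exists_regular_of_symmetric (n : ℕ) (T : Finset ℕ)
    (hT : ∀ x ∈ T, 0 < x ∧ x < n + 1 ∧ n + 1 - x ∈ T) :
    ∃ G : SimpleGraph (ZMod (n + 1)), ∀ v, (G.neighborFinset v).card = T.card := by
  let S : Finset (ZMod (n + 1)) := T.image (fun x : ℕ => (x : ZMod (n + 1)))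
  have hinj : Set.InjOn (fun x : ℕ => (x : ZMod (n + 1))) T := by
    intro x hx y hy h
    have h := (ZMod.natCast_eq_natCast_iff' x y (n + 1)).1 h
    rwa [Nat.mod_eq_of_lt (hT x hx).2.1, Nat.mod_eq_of_lt (hT y hy).2.1] at h
  have hneg : ∀ x ∈ S, -x ∈ S := by
    intro x hx
    obtain ⟨t, ht, rfl⟩ := Finset.mem_image.1 hx
    refine Finset.mem_image.2 ⟨n + 1 - t, (hT t ht).2.2, ?_⟩
    rw [Nat.cast_sub (hT t ht).2.1.le, ZMod.natCast_self, zero_sub]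
  have h0 : (0 : ZMod (n + 1)) ∉ S := by
    intro h
    obtain ⟨t, ht, h⟩ := Finset.mem_image.1 h
    rw [ZMod.natCast_eq_zero_iff] at h
    have := Nat.le_of_dvd (hT t ht).1 h
    have := (hT t ht).2.1
    omega
  refine ⟨SimpleGraph.circulantGraph (S : Set (ZMod (n + 1))), fun v => ?_⟩
  rw [← Finset.card_image_of_injOn hinj, ← Finset.card_image_of_injective S
    (add_left_injective v)]
  congr 1
  ext u
  rw [SimpleGraph.mem_neighborFinset]
  simp only [SimpleGraph.circulantGraph, SimpleGraph.fromRel_adj, Finset.mem_coe, Finset.mem_image]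
  constructor
  · rintro ⟨-, h | h⟩
    · exact ⟨u - v, by simpa using hneg _ h, by simp⟩
    · exact ⟨u - v, h, by simp⟩
  · rintro ⟨x, hx, rfl⟩
    refine ⟨fun h => h0 ?_, Or.inr (by simpa using hx)⟩
    have : x = 0 := by simpa using h.symm
    exact this ▸ hx

theorem regularGraphs_nonempty {N d : ℕ} (hN : d + 2 ≤ N) (hev : Even (N * d)) :
    (regularGraphs N d).Nonempty := by
  obtain ⟨n, rfl⟩ : ∃ n, N = n + 1 := ⟨N - 1, by omega⟩
  suffices h : ∃ T : Finset ℕ, T.card = d ∧ ∀ x ∈ T, 0 < x ∧ x < n + 1 ∧ n + 1 - x ∈ T by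
    obtain ⟨T, hd, hT⟩ := h
    obtain ⟨G, hG⟩ := exists_regular_of_symmetric n T hT
    -- `ZMod (n + 1)` unfolds to `Fin (n + 1)`, so the circulant graph already has the required
    -- vertex type.
    exact ⟨(G : SimpleGraph (Fin (n + 1))), mem_regularGraphs.2 fun v => (hG v).trans hd⟩
  rcases Nat.even_or_odd' d with ⟨e, rfl | rfl⟩
  · refine ⟨Finset.Icc 1 e ∪ Finset.Icc (n + 1 - e) n, ?_, ?_⟩
    · rw [Finset.card_union_of_disjoint, Nat.card_Icc, Nat.card_Icc]
      · omega
      · rw [Finset.disjoint_left]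
        intro x
        simp only [Finset.mem_Icc]
        omega
    · intro x
      simp only [Finset.mem_union, Finset.mem_Icc]
      omega
  · obtain ⟨c, hc⟩ : Even (n + 1) := by
      rcases Nat.even_mul.1 hev with h | h
      · exact h
      · exact absurd h (by simp)
    -- For odd `d` the number of vertices is even, and the antipodal difference `c`, which is its
    -- own negative, supplies the missing neighbour.
    refine ⟨insert c (Finset.Icc 1 e ∪ Finset.Icc (n + 1 - e) n), ?_, ?_⟩
    · rw [Finset.card_insert_of_notMem, Finset.card_union_of_disjoint, Nat.card_Icc, Nat.card_Icc]
      · omega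
      · rw [Finset.disjoint_left]
        intro x
        simp only [Finset.mem_Icc]
        omega
      · simp only [Finset.mem_union, Finset.mem_Icc]
        omega
    · intro x
      simp only [Finset.mem_insert, Finset.mem_union, Finset.mem_Icc]
      omega

end Existence

/-! ### Spectral moments as sums over closed walks -/

section Moments

theorem sum_eigenvalues_pow {n : Type*} [Fintype n] [DecidableEq n] {A : Matrix n n ℝ}
    (hA : A.IsHermitian) (k : ℕ) : ∑ i, hA.eigenvalues i ^ k = (A ^ k).trace := by
  conv_rhs => rw [hA.spectral_theorem, ← map_pow, Unitary.conjStarAlgAut_apply,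
    Matrix.trace_mul_cycle]
  simp [Matrix.diagonal_pow, Matrix.trace_diagonal]

theorem moment_spectralMeasure {N : ℕ} (G : SimpleGraph (Fin N)) (w : Sym2 (Fin N) → ℝ) (k : ℕ) :
    moment (spectralMeasure G w) k = (N : ℝ)⁻¹ * (weightedAdj G w ^ k).trace := by
  rw [moment, spectralMeasure, integral_smul_measure, integral_finsetSum_measure
    (fun i _ => integrable_dirac (by simp))]
  simp only [integral_dirac]
  rw [sum_eigenvalues_pow]
  simp

theorem weightedAdj_pow_apply {N : ℕ} (G : SimpleGraph (Fin N)) (w : Sym2 (Fin N) → ℝ)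
    (v u : Fin N) (t : ℕ) :
    (weightedAdj G w ^ t) v u =
      ∑ p ∈ walks G v t, if p t = u then ∏ i : Fin t, w (edgeString t p i) else 0 := by
  induction t generalizing u with
  | zero => simp [walks, Matrix.one_apply, Finset.sum_singleton, -Finset.sum_boole]
  | succ t ih =>
    rw [pow_succ, Matrix.mul_apply, sum_walks_succ]
    simp only [ih, Finset.sum_mul, ite_mul, zero_mul]
    rw [Finset.sum_comm]
    refine Finset.sum_congr rfl fun p _ => ?_
    rw [Finset.sum_ite_eq Finset.univ (p t), if_pos (Finset.mem_univ _)]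
    simp only [Function.update_self]
    rw [Finset.sum_ite_eq' (G.neighborFinset (p t)) u]
    simp only [SimpleGraph.mem_neighborFinset, weightedAdj, Matrix.of_apply, mul_ite, mul_zero]
    refine if_congr Iff.rfl ?_ rfl
    rw [Fin.prod_univ_castSucc]
    congr 1
    · refine Finset.prod_congr rfl fun i _ => ?_
      congr 1
      exact (edgeString_update (k := t + 1) u (i := i.castSucc) i.2).symm
    · congr 1
      exact (edgeString_update_self (k := t + 1) u (Fin.last t)).symm

variable {W : Measure ℝ} [IsProbabilityMeasure W]

theorem prod_comp_eq_prod_pow {k : ℕ} {α : Type*} [Fintype α] (s : Fin k → α) (w : α → ℝ) :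
    ∏ i, w (s i) = ∏ a, w a ^ (Finset.univ.filter fun i => s i = a).card := by
  rw [← Finset.prod_fiberwise (s := Finset.univ) s]
  refine Finset.prod_congr rfl fun a _ => ?_
  rw [← Finset.prod_const]
  exact Finset.prod_congr rfl fun i hi => by rw [(Finset.mem_filter.1 hi).2]

theorem integrable_prod_weights (hW : ∀ n : ℕ, Integrable (fun x : ℝ => x ^ n) W) {k : ℕ}
    {α : Type*} [Fintype α] (s : Fin k → α) :
    Integrable (fun w : α → ℝ => ∏ i, w (s i)) (Measure.pi fun _ => W) := by
  simp only [prod_comp_eq_prod_pow]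
  exact Integrable.fintype_prod (f := fun a (x : ℝ) =>
    x ^ (Finset.univ.filter fun i => s i = a).card) fun a => hW _

/-- By independence the integral factors over all symbols. Those absent from the string contribute
the zeroth moment, which is 1 for a probability measure. -/
theorem integral_prod_weights {k : ℕ} {α : Type*} [Fintype α] (s : Fin k → α) :
    ∫ w : α → ℝ, ∏ i, w (s i) ∂(Measure.pi fun _ => W) = stringMoment W s := by
  simp only [prod_comp_eq_prod_pow]
  rw [integral_fintype_prod_eq_prod (f := fun a (x : ℝ) =>
    x ^ (Finset.univ.filter fun i => s i = a).card), stringMoment]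
  have hinj : Set.InjOn s (firsts s) := by
    intro i hi j hj h
    have hi : IsFirst s i := by simpa [firsts] using hi
    have hj : IsFirst s j := by simpa [firsts] using hj
    rcases lt_trichotomy i j with h' | h' | h'
    · exact absurd h (hj i h')
    · exact h'
    · exact absurd h.symm (hi j h')
  symm
  have : ∏ i ∈ firsts s, moment W (signature s i) = ∏ a ∈ (firsts s).image s,
      moment W (Finset.univ.filter fun l => s l = a).card := by
    rw [Finset.prod_image hinj]
    rfl
  rw [this]
  refine Finset.prod_subset (Finset.subset_univ _) fun a _ ha => ?_
  have hempty : (Finset.univ.filter fun l => s l = a) = ∅ := by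
    by_contra hne
    obtain ⟨i, hi, hmin⟩ := Finset.exists_min_image _ id (Finset.nonempty_iff_ne_empty.2 hne)
    have hi : s i = a := by simpa using hi
    refine ha (Finset.mem_image.2 ⟨i, ?_, hi⟩)
    simp only [firsts, Finset.mem_filter, Finset.mem_univ, true_and]
    intro j hj e
    exact absurd (hmin j (by simpa [hi] using e)) (by simpa using hj)
  rw [hempty]
  simp [moment]

/-- The total moment contribution of the closed walks of length `k` from `v`. -/
def localMoment (W : Measure ℝ) {N : ℕ} (G : SimpleGraph (Fin N)) (k : ℕ) (v : Fin N) : ℝ :=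
  ∑ p ∈ (walks G v k).filter fun p => p k = v, stringMoment W (edgeString k p)

theorem moment_spectralMeasure_eq_sum {N : ℕ} (G : SimpleGraph (Fin N)) (w : Sym2 (Fin N) → ℝ)
    (k : ℕ) : moment (spectralMeasure G w) k = (N : ℝ)⁻¹ * ∑ v,
      ∑ p ∈ (walks G v k).filter fun p => p k = v, ∏ i, w (edgeString k p i) := by
  rw [moment_spectralMeasure, Matrix.trace]
  simp only [Matrix.diag_apply, weightedAdj_pow_apply, Finset.sum_filter]

theorem integrable_moment_spectralMeasure (hW : ∀ n : ℕ, Integrable (fun x : ℝ => x ^ n) W)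
    {N : ℕ} (G : SimpleGraph (Fin N)) (k : ℕ) :
    Integrable (fun w => moment (spectralMeasure G w) k) (weightLaw W N) := by
  simp only [moment_spectralMeasure_eq_sum]
  exact (integrable_finsetSum _ fun v _ => integrable_finsetSum _ fun p _ =>
    integrable_prod_weights hW _).const_mul _

theorem graphMoment_eq_sum (hW : ∀ n : ℕ, Integrable (fun x : ℝ => x ^ n) W)
    {N : ℕ} (G : SimpleGraph (Fin N)) (k : ℕ) :
    graphMoment W G k = (N : ℝ)⁻¹ * ∑ v, localMoment W G k v := by
  simp only [graphMoment, moment_spectralMeasure_eq_sum, weightLaw, integral_const_mul]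
  rw [integral_finsetSum _ fun v _ => integrable_finsetSum _ fun p _ =>
    integrable_prod_weights hW _]
  congr 1
  refine Finset.sum_congr rfl fun v _ => ?_
  rw [integral_finsetSum _ fun p _ => integrable_prod_weights hW _]
  exact Finset.sum_congr rfl fun p _ => integral_prod_weights _

/-- A bound for the moment contributions of the strings of length `k`. -/
def momentBound (W : Measure ℝ) (k : ℕ) : ℝ := (1 + ∑ j ∈ Finset.range (k + 1), |moment W j|) ^ k

/-- There are at most `k` factors, each a moment of order at most `k`; the added 1 makes the base at
least 1, so the exponent can be raised to `k`. -/
theorem abs_stringMoment_le (W : Measure ℝ) {k : ℕ} {α : Type*} (s : Fin k → α) :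
    |stringMoment W s| ≤ momentBound W k := by
  rw [stringMoment, Finset.abs_prod, momentBound]
  have h1 : (1 : ℝ) ≤ 1 + ∑ j ∈ Finset.range (k + 1), |moment W j| :=
    le_add_of_nonneg_right (Finset.sum_nonneg fun _ _ => abs_nonneg _)
  calc ∏ i ∈ firsts s, |moment W (signature s i)|
      ≤ ∏ i ∈ firsts s, (1 + ∑ j ∈ Finset.range (k + 1), |moment W j|) := by
        refine Finset.prod_le_prod (fun _ _ => abs_nonneg _) fun i _ => ?_
        have hi : signature s i ∈ Finset.range (k + 1) := by
          rw [Finset.mem_range, Nat.lt_succ_iff, signature]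
          exact (Finset.card_le_univ _).trans (by simp)
        have := Finset.single_le_sum (f := fun j => |moment W j|) (fun _ _ => abs_nonneg _) hi
        linarith
    _ = (1 + ∑ j ∈ Finset.range (k + 1), |moment W j|) ^ (firsts s).card := by
        rw [Finset.prod_const]
    _ ≤ _ := pow_le_pow_right₀ h1 ((Finset.card_le_univ _).trans (by simp))

theorem abs_localMoment_le (W : Measure ℝ) {N d : ℕ} {G : SimpleGraph (Fin N)}
    (hG : ∀ v, (G.neighborFinset v).card = d) (k : ℕ) (v : Fin N) :
    |localMoment W G k v| ≤ d ^ k * momentBound W k := by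
  have h0 : 0 ≤ momentBound W k :=
    pow_nonneg (add_nonneg zero_le_one (Finset.sum_nonneg fun _ _ => abs_nonneg _)) _
  refine (Finset.abs_sum_le_sum_abs _ _).trans
    ((Finset.sum_le_card_nsmul _ _ _ fun p _ => abs_stringMoment_le W _).trans ?_)
  rw [nsmul_eq_mul]
  refine mul_le_mul_of_nonneg_right ?_ h0
  have := (Finset.card_filter_le (walks G v k) fun p => p k = v).trans (card_walks hG v k).le
  exact_mod_cast this

end Moments

/-! ### Comparison with the pattern sum and passage to the limit -/

section Expansion

/-- The limit of the averaged spectral moments. -/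
def patternSum (W : Measure ℝ) (d k : ℕ) : ℝ :=
  ∑ π : Pattern k, π.multiplicity (d : ℝ) * π.moment W

theorem IsTreeLikeAt.localMoment_eq (W : Measure ℝ) {N d k : ℕ} {G : SimpleGraph (Fin N)}
    (hG : ∀ v, (G.neighborFinset v).card = d) {v : Fin N} (hv : IsTreeLikeAt G k v) :
    localMoment W G k v = patternSum W d k := by
  let rep : Pattern k → {s : Fin k → Fin k // IsClosedAcyclic s} := Quotient.out
  have hrep : ∀ π : Pattern k, (Quotient.mk (patternSetoid k) (rep π) : Pattern k) = π :=
    Quotient.out_eq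
  have hex : ∀ p ∈ (walks G v k).filter fun p => p k = v,
      ∃ π : Pattern k, SamePattern (edgeString k p) (rep π).1 := by
    intro p hp
    obtain ⟨hp, hc⟩ := Finset.mem_filter.1 hp
    obtain ⟨r, hr⟩ := exists_samePattern_fin (edgeString k p)
    let r' : {s : Fin k → Fin k // IsClosedAcyclic s} :=
      ⟨r, hr.isClosedAcyclic (hv.isClosedAcyclic hp hc)⟩
    refine ⟨Quotient.mk (patternSetoid k) r', fun i j => (hr i j).trans ?_⟩
    have h : SamePattern (rep (Quotient.mk (patternSetoid k) r')).1 r :=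
      Quotient.exact (s := patternSetoid k) (hrep (Quotient.mk (patternSetoid k) r'))
    exact (h i j).symm
  have huniq : ∀ (p : ℕ → Fin N) (π π' : Pattern k), SamePattern (edgeString k p) (rep π).1 →
      SamePattern (edgeString k p) (rep π').1 → π = π' := by
    intro p π π' h h'
    rw [← hrep π, ← hrep π']
    exact Quotient.sound (s := patternSetoid k) fun i j => (h i j).symm.trans (h' i j)
  -- Each closed walk follows exactly one pattern, so its contribution is spread over all patterns
  -- by indicators and the two sums can be exchanged.
  have hpt : ∀ p ∈ (walks G v k).filter fun p => p k = v, stringMoment W (edgeString k p) =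
      ∑ π : Pattern k, if SamePattern (edgeString k p) (rep π).1 then π.moment W else 0 := by
    intro p hp
    obtain ⟨π, hπ⟩ := hex p hp
    rw [Finset.sum_eq_single π (fun π' _ hne => if_neg fun h => hne (huniq p _ _ h hπ))
      (fun h => absurd (Finset.mem_univ _) h), if_pos hπ, hπ.stringMoment_eq W]
    conv_rhs => rw [← hrep π]
    rfl
  rw [localMoment, Finset.sum_congr rfl hpt, Finset.sum_comm, patternSum]
  refine Finset.sum_congr rfl fun π _ => ?_
  rw [← Finset.sum_filter, Finset.sum_const, nsmul_eq_mul, Finset.filter_filter,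
    show π.multiplicity (d : ℝ) = stringMultiplicity (rep π).1 d by
      conv_lhs => rw [← hrep π]
      rfl,
    ← hv.card_samePattern hG (rep π).2]
  congr!

theorem patternSum_of_odd (W : Measure ℝ) (d : ℕ) {k : ℕ} (hk : Odd k) :
    patternSum W d k = 0 := by
  refine Finset.sum_eq_zero fun π _ => ?_
  exact absurd (Quotient.out π).2.even_length (Nat.not_even_iff_odd.2 hk)

variable {W : Measure ℝ} [IsProbabilityMeasure W]

/-- A bound for the deviation of a local moment from its tree value. -/
def deviationBound (W : Measure ℝ) (d k : ℕ) : ℝ := d ^ k * momentBound W k + |patternSum W d k|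

theorem deviationBound_nonneg (W : Measure ℝ) (d k : ℕ) : 0 ≤ deviationBound W d k := by
  have : 0 ≤ momentBound W k :=
    pow_nonneg (add_nonneg zero_le_one (Finset.sum_nonneg fun _ _ => abs_nonneg _)) _
  unfold deviationBound
  positivity

theorem abs_graphMoment_sub_le (hW : ∀ n : ℕ, Integrable (fun x : ℝ => x ^ n) W) {N d k : ℕ}
    (hN : 0 < N) {G : SimpleGraph (Fin N)} (hG : ∀ v, (G.neighborFinset v).card = d) :
    |graphMoment W G k - patternSum W d k| ≤
      (N : ℝ)⁻¹ * ∑ v, if IsTreeLikeAt G k v then 0 else deviationBound W d k := by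
  have hN' : (N : ℝ) ≠ 0 := by positivity
  have : graphMoment W G k - patternSum W d k =
      (N : ℝ)⁻¹ * ∑ v, (localMoment W G k v - patternSum W d k) := by
    rw [graphMoment_eq_sum hW, Finset.sum_sub_distrib, mul_sub]
    simp [hN']
  rw [this, abs_mul, abs_of_nonneg (by positivity)]
  refine mul_le_mul_of_nonneg_left ((Finset.abs_sum_le_sum_abs _ _).trans
    (Finset.sum_le_sum fun v _ => ?_)) (by positivity)
  split_ifs with hv
  · simp [hv.localMoment_eq W hG]
  · exact (abs_sub _ _).trans (add_le_add (abs_localMoment_le W hG k v) le_rfl)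

theorem abs_averageMoment_sub_le (hW : ∀ n : ℕ, Integrable (fun x : ℝ => x ^ n) W) {N d k : ℕ}
    (hN : 4 * (k + 1 + d) ≤ N) (hne : (regularGraphs N d).Nonempty) :
    |averageMoment W d N k - patternSum W d k| ≤
      deviationBound W d k * (2 * k ^ 2 * (d + 1) ^ (k + 2)) / N := by
  have hN0 : 0 < N := by omega
  have hNr : (0 : ℝ) < N := by exact_mod_cast hN0
  have hR : (0 : ℝ) < (regularGraphs N d).card := by exact_mod_cast hne.card_pos
  have hD := deviationBound_nonneg W d k
  have hsub : averageMoment W d N k - patternSum W d k =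
      (∑ G ∈ regularGraphs N d, (graphMoment W G k - patternSum W d k)) /
        (regularGraphs N d).card := by
    rw [averageMoment, Finset.sum_sub_distrib, Finset.sum_const, nsmul_eq_mul, sub_div,
      mul_div_cancel_left₀ _ hR.ne']
  rw [hsub, abs_div, abs_of_pos hR, div_le_iff₀ hR]
  calc |∑ G ∈ regularGraphs N d, (graphMoment W G k - patternSum W d k)|
      ≤ ∑ G ∈ regularGraphs N d, (N : ℝ)⁻¹ *
          ∑ v, if IsTreeLikeAt G k v then 0 else deviationBound W d k :=
        (Finset.abs_sum_le_sum_abs _ _).trans (Finset.sum_le_sum fun G hG =>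
          abs_graphMoment_sub_le hW hN0 (mem_regularGraphs.1 hG))
    -- Exchanging graphs and vertices lets the switching bound act at each fixed vertex.
    _ = (N : ℝ)⁻¹ * ∑ v : Fin N, deviationBound W d k *
          ((regularGraphs N d).filter fun G => ¬ IsTreeLikeAt G k v).card := by
        rw [← Finset.mul_sum, Finset.sum_comm]
        congr 1
        refine Finset.sum_congr rfl fun v _ => ?_
        rw [Finset.sum_ite, Finset.sum_const_zero, zero_add, Finset.sum_const, nsmul_eq_mul,
          mul_comm]
    _ ≤ (N : ℝ)⁻¹ * ∑ v : Fin N, deviationBound W d k *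
          ((regularGraphs N d).card * (2 * k ^ 2 * (d + 1) ^ (k + 2)) / N) := by
        gcongr with v
        rw [le_div_iff₀ hNr]
        simpa using card_not_isTreeLikeAt_le v d k (regularGraphs N d)
          (fun G => mem_regularGraphs) (by simpa using hN)
    _ = _ := by
        rw [Finset.sum_const, Finset.card_univ, Fintype.card_fin, nsmul_eq_mul]
        field_simp

theorem eventually_regularGraphs_nonempty (d : ℕ) :
    ∀ᶠ N in admissible d, (regularGraphs N d).Nonempty := by
  filter_upwards [mem_inf_of_left (eventually_ge_atTop (d + 2)),
    mem_inf_of_right (mem_principal_self _)] with N hN hev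
  exact regularGraphs_nonempty hN hev

theorem tendsto_averageMoment (hW : ∀ n : ℕ, Integrable (fun x : ℝ => x ^ n) W) (d k : ℕ) :
    Tendsto (fun N => averageMoment W d N k) (admissible d) (𝓝 (patternSum W d k)) := by
  rw [tendsto_iff_dist_tendsto_zero]
  refine squeeze_zero' (Eventually.of_forall fun _ => dist_nonneg) ?_
    ((tendsto_const_div_atTop_nhds_zero_nat
      (deviationBound W d k * (2 * k ^ 2 * (d + 1) ^ (k + 2)))).mono_left inf_le_left)
  filter_upwards [mem_inf_of_left (eventually_ge_atTop (4 * (k + 1 + d))),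
    eventually_regularGraphs_nonempty d] with N hN hne
  rw [Real.dist_eq]
  exact abs_averageMoment_sub_le hW hN hne

end Expansion

end WeightedRegular

end

theorem lemma2p4 (W : Measure ℝ) [IsProbabilityMeasure W]
    (hW : ∀ n : ℕ, Integrable (fun x : ℝ => x ^ n) W) (d : ℕ) :
    -- the averages are well defined
    (∀ᶠ N in WeightedRegular.admissible d, (WeightedRegular.regularGraphs N d).Nonempty) ∧
    (∀ N k : ℕ, ∀ G ∈ WeightedRegular.regularGraphs N d,
      Integrable (fun w => WeightedRegular.moment (WeightedRegular.spectralMeasure G w) k)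
        (WeightedRegular.weightLaw W N)) ∧
    -- the moment expansion
    (∀ k : ℕ, Tendsto (fun N => WeightedRegular.averageMoment W d N k)
      (WeightedRegular.admissible d)
      (𝓝 (∑ π : WeightedRegular.Pattern k, π.multiplicity (d : ℝ) * π.moment W))) ∧
    -- the odd moments vanish in the limit
    (∀ k : ℕ, Odd k → Tendsto (fun N => WeightedRegular.averageMoment W d N k)
      (WeightedRegular.admissible d) (𝓝 0)) :=
  ⟨WeightedRegular.eventually_regularGraphs_nonempty d,
    fun _ k G _ => WeightedRegular.integrable_moment_spectralMeasure hW G k,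
    fun k => WeightedRegular.tendsto_averageMoment hW d k,
    fun k hk => WeightedRegular.patternSum_of_odd W d hk ▸
      WeightedRegular.tendsto_averageMoment hW d k⟩
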